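/- Let $d\in\{2,3\}$ and let $\Omega\subset\mathbb R^d$ be a bounded domain (a nonempty, connected, bounded open set; in particular any bounded polyhedral domain). Let $V=H^1_0(\Omega)^d$, where $H^1_0(\Omega)$ is the closure of $C_c^\infty(\Omega)$ in $H^1(\Omega)$, let $Q=L^2_0(\Omega)=\{q\in L^2(\Omega):\int_\Omega q\,dx=0\}$, and let $V_{\mathrm{div}}=\{v\in V:\int_\Omega(\operatorname{div}v)\,q\,dx=0\ \ \forall q\in Q\}$. Put $$a(v,w)=\int_\Omega\nabla v:\nabla w\,dx,\qquad |v|_V=a(v,v)^{1/2},\qquad a_{\mathrm{rot}}(u,v,w)=\int_\Omega\big((\operatorname{curl}u)\times v\big)\cdot w\,dx,$$ where for $d=2$ $\operatorname{curl}u=\partial_1u_2-\partial_2u_1$ is a scalar and $\omega\times v=(-\omega v_2,\omega v_1)$, while for $d=3$ the curl and the cross product are the usual ones. Let $\mathcal H$ be the closed subspace of all $v\in L^2(\Omega)^d$ with $\int_\Omega v\cdot\nabla q\,dx=0$ for every $q\in H^1(\Omega)\cap L^2_0(\Omega)$, and let $P_{\mathcal H}:L^2(\Omega)^d\to\mathcal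 H$ be the $L^2$-orthogonal projection (the Helmholtz projection). Then the integrand of $a_{\mathrm{rot}}(u,v,w)$ is integrable for all $u,v,w\in V$; there is a constant $N>0$ with $$|a_{\mathrm{rot}}(u,v,w)|\le N\,|u|_V|v|_V|w|_V\qquad\forall u,v,w\in V;\tag{1}$$ and there is a constant $C_P>0$ with $$\|v\|_{L^2(\Omega)^d}\le C_P|v|_V\qquad\forall v\in V.\tag{2}$$ Moreover, let $N>0$ and $C_P>0$ be any constants satisfying (1) and (2), let $\nu>0$ and $f\in L^2(\Omega)^d$, and consider the reduced problem: find $u\in V_{\mathrm{div}}$ such that $$\nu\,a(u,v)+a_{\mathrm{rot}}(u,u,v)=\int_\Omega f\cdot v\,dx\qquad\forall v\in V_{\mathrm{div}}.\tag{3}$$ 1. Every solution $u\in V_{\mathrm{div}}$ of (3) satisfies $|u|_V\le \dfrac{C_P}{\nu}\,\|P_{\mathcal H}f\|_{L^2(\Omega)^d}$. 2. If $\dfrac{N C_P}{\nu^2}\,\|P_{\mathcal H}f\|_{L^2(\Omega)^d}<1$, then problem (3) has a unique solution $u\in V_{\mathrm{div}}$. -/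

import Mathlib

open MeasureTheory Filter Topology
open scoped ContDiff

noncomputable section

namespace RotNS

/-- The Lebesgue space of square-integrable real functions on `Ω ⊆ ℝ^d` (modulo equality a.e.). -/
abbrev L2 {d : ℕ} (Ω : Set (EuclideanSpace ℝ (Fin d))) : Type :=
  Lp ℝ 2 (volume.restrict Ω)

/-- `L²(Ω)^d` with the Hilbert norm `‖v‖² = ∑ i, ‖v i‖²`. -/
abbrev L2Vec {d : ℕ} (Ω : Set (EuclideanSpace ℝ (Fin d))) : Type :=
  PiLp 2 (fun _ : Fin d => L2 Ω)

/-- The classical partial derivative `∂φ/∂x_i`. -/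
def pderiv {d : ℕ} (i : Fin d) (φ : EuclideanSpace ℝ (Fin d) → ℝ)
    (x : EuclideanSpace ℝ (Fin d)) : ℝ :=
  fderiv ℝ φ x (EuclideanSpace.single i 1)

/-- Test functions: smooth functions with compact support contained in `Ω`. -/
structure IsTestFunction {d : ℕ} (Ω : Set (EuclideanSpace ℝ (Fin d)))
    (φ : EuclideanSpace ℝ (Fin d) → ℝ) : Prop where
  smooth : ContDiff ℝ ∞ φ
  compact : HasCompactSupport φ
  support : tsupport φ ⊆ Ω

/-- `g ∈ L²(Ω)` is the weak (distributional) derivative `∂u/∂x_i` of `u` in `Ω`. -/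
def HasWeakPartial {d : ℕ} (Ω : Set (EuclideanSpace ℝ (Fin d))) (i : Fin d) (u g : L2 Ω) : Prop :=
  ∀ φ : EuclideanSpace ℝ (Fin d) → ℝ, IsTestFunction Ω φ →
    ∫ x in Ω, u x * pderiv i φ x = - ∫ x in Ω, g x * φ x

/-- `u ∈ H¹(Ω)`. -/
def MemH1 {d : ℕ} (Ω : Set (EuclideanSpace ℝ (Fin d))) (u : L2 Ω) : Prop :=
  ∀ i : Fin d, ∃ g : L2 Ω, HasWeakPartial Ω i u g

open Classical in
/-- The weak partial derivative `∂u/∂x_i ∈ L²(Ω)`; it is only used for `u ∈ H¹(Ω)`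
(it is `0` if there is no weak derivative in `L²(Ω)`). -/
def weakPartial {d : ℕ} (Ω : Set (EuclideanSpace ℝ (Fin d))) (i : Fin d) (u : L2 Ω) : L2 Ω :=
  if h : ∃ g : L2 Ω, HasWeakPartial Ω i u g then h.choose else 0

theorem weakPartial_spec {d : ℕ} {Ω : Set (EuclideanSpace ℝ (Fin d))} {u : L2 Ω}
    (hu : MemH1 Ω u) (i : Fin d) : HasWeakPartial Ω i u (weakPartial Ω i u) := by
  unfold weakPartial
  rw [dif_pos (hu i)]
  exact (hu i).choose_spec

/-- Weak derivatives in an open set are unique. -/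
theorem HasWeakPartial.unique {d : ℕ} {Ω : Set (EuclideanSpace ℝ (Fin d))} (hΩ : IsOpen Ω)
    {i : Fin d} {u g h : L2 Ω} (hg : HasWeakPartial Ω i u g) (hh : HasWeakPartial Ω i u h) :
    g = h := by
  have hloc : ∀ k : L2 Ω, LocallyIntegrable k (volume.restrict Ω) := fun k =>
    (Lp.memLp k).locallyIntegrable (by norm_num)
  have key : ∀ᵐ x ∂(volume : Measure (EuclideanSpace ℝ (Fin d))), x ∈ Ω → g x - h x = 0 := by
    refine hΩ.ae_eq_zero_of_integral_contDiff_smul_eq_zero (f := fun x => g x - h x) ?_ ?_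
    · have : LocallyIntegrable (fun x => g x - h x) (volume.restrict Ω) := (hloc g).sub (hloc h)
      exact locallyIntegrableOn_of_locallyIntegrable_restrict this
    · intro φ h1 h2 h3
      have e : ∫ x in Ω, g x * φ x = ∫ x in Ω, h x * φ x := by
        have a := hg φ ⟨h1, h2, h3⟩
        have b := hh φ ⟨h1, h2, h3⟩
        linarith
      have hint : ∀ k : L2 Ω, Integrable (fun x => k x * φ x) (volume.restrict Ω) := fun k => by
        have := (hloc k).integrable_smul_left_of_hasCompactSupport h1.continuous h2
        simpa [smul_eq_mul, mul_comm] using this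
      have hz : ∫ x in Ω, φ x • (g x - h x) = 0 := by
        have : (fun x => φ x • (g x - h x)) = fun x => g x * φ x - h x * φ x := by
          funext x; simp only [smul_eq_mul]; ring
        rw [this, integral_sub (hint g) (hint h), e, sub_self]
      rw [← hz]
      symm
      refine setIntegral_eq_integral_of_forall_compl_eq_zero fun x hx => ?_
      have : φ x = 0 := by
        by_contra h0
        exact hx (h3 (subset_tsupport φ h0))
      rw [this, zero_smul]
  apply Lp.ext
  filter_upwards [(ae_restrict_iff' hΩ.measurableSet).2 key] with x hx
  linarith

/-- `u ∈ H¹₀(Ω)`: `u` is a limit of test functions in the norm of `H¹(Ω)`. -/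
def MemH10 {d : ℕ} (Ω : Set (EuclideanSpace ℝ (Fin d))) (u : L2 Ω) : Prop :=
  MemH1 Ω u ∧ ∃ φ : ℕ → EuclideanSpace ℝ (Fin d) → ℝ,
    (∀ n, IsTestFunction Ω (φ n)) ∧
    Tendsto (fun n => eLpNorm (fun x => φ n x - u x) 2 (volume.restrict Ω)) atTop (𝓝 0) ∧
    ∀ i : Fin d, Tendsto
      (fun n => eLpNorm (fun x => pderiv i (φ n) x - weakPartial Ω i u x) 2 (volume.restrict Ω))
      atTop (𝓝 0)

/-- `u ∈ V = H¹₀(Ω)^d`. -/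
def MemV {d : ℕ} (Ω : Set (EuclideanSpace ℝ (Fin d))) (u : L2Vec Ω) : Prop :=
  ∀ i : Fin d, MemH10 Ω (u i)

/-- `q ∈ Q = L²₀(Ω)`: the square-integrable functions with integral zero. -/
def MemQ {d : ℕ} (Ω : Set (EuclideanSpace ℝ (Fin d))) (q : L2 Ω) : Prop :=
  ∫ x in Ω, q x = 0

/-- `a(v,w) = ∫_Ω ∇v : ∇w`. -/
def aForm {d : ℕ} (Ω : Set (EuclideanSpace ℝ (Fin d))) (v w : L2Vec Ω) : ℝ :=
  ∫ x in Ω, ∑ i, ∑ j, weakPartial Ω j (v i) x * weakPartial Ω j (w i) x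

/-- `|v|_V`, the `H¹(Ω)^d` seminorm, i.e. the `L²` norm of `∇v`. -/
def seminormV {d : ℕ} (Ω : Set (EuclideanSpace ℝ (Fin d))) (v : L2Vec Ω) : ℝ :=
  √(aForm Ω v v)

/-- The weak divergence of `v ∈ H¹(Ω)^d`. -/
def weakDiv {d : ℕ} (Ω : Set (EuclideanSpace ℝ (Fin d))) (v : L2Vec Ω) : L2 Ω :=
  ∑ i, weakPartial Ω i (v i)

/-- `b(v,q) = -∫_Ω (div v) q`. -/
def bForm {d : ℕ} (Ω : Set (EuclideanSpace ℝ (Fin d))) (v : L2Vec Ω) (q : L2 Ω) : ℝ :=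
  - ∫ x in Ω, weakDiv Ω v x * q x

/-- `v ∈ V_div`. -/
def MemVdiv {d : ℕ} (Ω : Set (EuclideanSpace ℝ (Fin d))) (v : L2Vec Ω) : Prop :=
  MemV Ω v ∧ ∀ q : L2 Ω, MemQ Ω q → bForm Ω v q = 0

/-- The vector `(curl u) × v` at a point, where `G i j = ∂u_i/∂x_j` are the values of the
derivatives of `u` and `v` is the value of the second field at that point.
For `d = 2` the curl is the scalar `ω = ∂u₂/∂x₁ - ∂u₁/∂x₂` and `ω × v = (-ω v₂, ω v₁)`;
for `d = 3` it is the usual vector curl and the usual cross product.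
Only `d = 2` and `d = 3` are used. -/
def curlCross : (d : ℕ) → (Fin d → Fin d → ℝ) → (Fin d → ℝ) → (Fin d → ℝ)
  | 2, G, v => ![-((G 1 0 - G 0 1) * v 1), (G 1 0 - G 0 1) * v 0]
  | 3, G, v => crossProduct ![G 2 1 - G 1 2, G 0 2 - G 2 0, G 1 0 - G 0 1] v
  | _, _, _ => 0

/-- The integrand `((curl u) × v) · w` of the rotational form. -/
def rotIntegrand {d : ℕ} (Ω : Set (EuclideanSpace ℝ (Fin d))) (u v w : L2Vec Ω)
    (x : EuclideanSpace ℝ (Fin d)) : ℝ :=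
  ∑ k, curlCross d (fun i j => weakPartial Ω j (u i) x) (fun i => v i x) k * w k x

/-- `a_rot(u,v,w) = ∫_Ω ((curl u) × v) · w`. -/
def aRot {d : ℕ} (Ω : Set (EuclideanSpace ℝ (Fin d))) (u v w : L2Vec Ω) : ℝ :=
  ∫ x in Ω, rotIntegrand Ω u v w x

/-- `∫_Ω f · v`. -/
def load {d : ℕ} (Ω : Set (EuclideanSpace ℝ (Fin d))) (f v : L2Vec Ω) : ℝ :=
  ∫ x in Ω, ∑ i, f i x * v i x

theorem load_eq_inner {d : ℕ} (Ω : Set (EuclideanSpace ℝ (Fin d))) (f v : L2Vec Ω) :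
    load Ω f v = inner ℝ f v := by
  have hi : ∀ i : Fin d, Integrable (fun x => f i x * v i x) (volume.restrict Ω) := fun i => by
    have := L2.integrable_inner (𝕜 := ℝ) (v i) (f i)
    simpa using this
  rw [load, integral_finsetSum _ fun i _ => hi i, PiLp.inner_apply]
  refine Finset.sum_congr rfl fun i _ => ?_
  rw [L2.inner_def]
  refine integral_congr_ae (Eventually.of_forall fun x => ?_)
  simp [mul_comm]

/-- The gradient `∇q ∈ L²(Ω)^d` of `q ∈ H¹(Ω)`. -/
def weakGrad {d : ℕ} (Ω : Set (EuclideanSpace ℝ (Fin d))) (q : L2 Ω) : L2Vec Ω :=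
  WithLp.toLp 2 fun i => weakPartial Ω i q

/-- The space `𝓗` of `L²` fields `v` with `div v = 0` and `v · n = 0` on the boundary, that is,
`∫_Ω (v · ∇) q = 0` for all `q ∈ H¹(Ω) ∩ L²₀(Ω)`. -/
def solenoidal {d : ℕ} (Ω : Set (EuclideanSpace ℝ (Fin d))) : Submodule ℝ (L2Vec Ω) where
  carrier := {v | ∀ q : L2 Ω, MemH1 Ω q → MemQ Ω q → load Ω v (weakGrad Ω q) = 0}
  add_mem' := fun {v w} hv hw q h1 h2 => by
    have a := hv q h1 h2
    have b := hw q h1 h2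
    rw [load_eq_inner] at a b ⊢
    rw [inner_add_left, a, b, add_zero]
  zero_mem' := fun q _ _ => by rw [load_eq_inner, inner_zero_left]
  smul_mem' := fun c v hv q h1 h2 => by
    have a := hv q h1 h2
    rw [load_eq_inner] at a ⊢
    rw [inner_smul_left, a, mul_zero]

theorem isClosed_solenoidal {d : ℕ} (Ω : Set (EuclideanSpace ℝ (Fin d))) :
    IsClosed (solenoidal Ω : Set (L2Vec Ω)) := by
  have : (solenoidal Ω : Set (L2Vec Ω)) =
      ⋂ (q : L2 Ω) (_ : MemH1 Ω q) (_ : MemQ Ω q), {v | inner ℝ v (weakGrad Ω q) = 0} := by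
    ext v
    simp only [Set.mem_iInter, Set.mem_ofPred_eq, ← load_eq_inner]
    rfl
  rw [this]
  exact isClosed_iInter fun q => isClosed_iInter fun _ => isClosed_iInter fun _ =>
    isClosed_eq (by fun_prop) continuous_const

instance {d : ℕ} (Ω : Set (EuclideanSpace ℝ (Fin d))) : CompleteSpace (solenoidal Ω) :=
  (isClosed_solenoidal Ω).completeSpace_coe

/-- The Helmholtz projection `P_𝓗`: the `L²`-orthogonal projection onto `𝓗`. -/
def helmholtz {d : ℕ} (Ω : Set (EuclideanSpace ℝ (Fin d))) (f : L2Vec Ω) : L2Vec Ω :=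
  (solenoidal Ω).starProjection f

/-- If `f = f₀ + ∇φ` with `f₀ ∈ 𝓗` and `φ ∈ H¹(Ω) ∩ L²₀(Ω)`, then `P_𝓗 f = f₀`. -/
theorem helmholtz_eq {d : ℕ} (Ω : Set (EuclideanSpace ℝ (Fin d))) {f f₀ : L2Vec Ω} {φ : L2 Ω}
    (h0 : f₀ ∈ solenoidal Ω) (h1 : MemH1 Ω φ) (h2 : MemQ Ω φ) (h : f = f₀ + weakGrad Ω φ) :
    helmholtz Ω f = f₀ := by
  refine Submodule.eq_starProjection_of_mem_of_inner_eq_zero h0 fun w hw => ?_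
  rw [h, add_sub_cancel_left, real_inner_comm, ← load_eq_inner]
  exact hw φ h1 h2

/-- `N` is a positive constant with `|a_rot(u,v,w)| ≤ N |u|_V |v|_V |w|_V` on `V`. -/
def IsTrilinearConstant {d : ℕ} (Ω : Set (EuclideanSpace ℝ (Fin d))) (N : ℝ) : Prop :=
  0 < N ∧ ∀ u v w : L2Vec Ω, MemV Ω u → MemV Ω v → MemV Ω w →
    |aRot Ω u v w| ≤ N * seminormV Ω u * seminormV Ω v * seminormV Ω w

/-- `C` is a positive constant with `‖v‖_{L²} ≤ C |v|_V` on `V`. -/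
def IsPoincareConstant {d : ℕ} (Ω : Set (EuclideanSpace ℝ (Fin d))) (C : ℝ) : Prop :=
  0 < C ∧ ∀ v : L2Vec Ω, MemV Ω v → ‖v‖ ≤ C * seminormV Ω v

/-- `u ∈ V_div` solves the reduced problem
`ν a(u,v) + a_rot(u,u,v) = ∫_Ω f · v` for all `v ∈ V_div`. -/
def IsReducedSolution {d : ℕ} (Ω : Set (EuclideanSpace ℝ (Fin d))) (ν : ℝ) (f u : L2Vec Ω) :
    Prop :=
  MemVdiv Ω u ∧ ∀ v : L2Vec Ω, MemVdiv Ω v →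
    ν * aForm Ω u v + aRot Ω u u v = load Ω f v

end RotNS

end

/-!
The trilinear bound and the Poincaré inequality both come from the embedding `H¹₀(Ω) ⊆ L⁴(Ω)` for
`d = 2, 3` (`exists_eLpNorm_four_le`), which is the Gagliardo–Nirenberg–Sobolev inequality
`‖φ‖₄ ≤ C ‖∇φ‖ₚ` with `p = 4d/(d+4) ≤ 2` for test functions, Hölder's inequality on the bounded set
`Ω`, and a passage to the limit. In both dimensions `(curl u) × v = (∇u - ∇uᵀ) v`
(`sum_curlCross_mul`), so `a_rot` is a finite sum of integrals `∫ g a b` with `g ∈ L²` and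
`a, b ∈ L⁴`; this gives integrability, trilinearity and the bound, while antisymmetry of
`∇u - ∇uᵀ` gives `a_rot(u, v, v) = 0` (`aRot_self_right`).

Since `H¹₀(Ω)` is the closure of the pairs `(φ, ∇φ)` (`memH10_iff`), the gradient identifies `V_div`
with a complete subspace of a Hilbert space (`isComplete_range_gradientLinear`), on which the energy
form is the inner product. Integration by parts gives `V_div ⊆ 𝓗` (`MemVdiv.mem_solenoidal`), hence
`∫ f · v = ∫ P_𝓗 f · v ≤ C_P ‖P_𝓗 f‖ |v|_V` for `v ∈ V_div` (`abs_load_le`). The a priori bound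
follows by testing with `v = u` (`norm_le_of_energy`).

For small data no compactness is needed. For fixed `w`, Lax–Milgram solves
`ν a(u, v) + a_rot(w, u, v) = ∫ f · v`, and the map `w ↦ u` is Lipschitz with constant
`N C_P ‖P_𝓗 f‖ / ν² < 1` (`existsUnique_of_small`), so Banach's theorem yields the unique solution.
-/

namespace RotNS

/-! ### Small data in a Hilbert space -/

section Abstract

variable {W : Type*} [NormedAddCommGroup W] [InnerProductSpace ℝ W]

/-- The energy estimate: the equation tested with its own solution `u`, where `b(u, u) = 0`. -/
theorem norm_le_of_energy {ν K : ℝ} (hν : 0 < ν) (hK : 0 ≤ K) {b ℓ : W → ℝ} {u : W}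
    (hb : b u = 0) (hℓ : |ℓ u| ≤ K * ‖u‖) (hu : ν * inner ℝ u u + b u = ℓ u) : ‖u‖ ≤ K / ν := by
  rw [hb, add_zero, real_inner_self_eq_norm_sq] at hu
  rcases eq_or_lt_of_le (norm_nonneg u) with h0 | h0
  · rw [← h0]
    positivity
  · rw [le_div_iff₀ hν]
    refine le_of_mul_le_mul_right ?_ h0
    linarith [le_abs_self (ℓ u)]

/-- The Oseen problem: for a fixed convecting field `w`, Lax–Milgram solves
`ν ⟪u, v⟫ + b(u, v) = ℓ(v)` when `b` is bounded and `b(v, v) = 0`. -/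
theorem exists_linearized_solution [CompleteSpace W] {ν K C : ℝ} (hν : 0 < ν)
    {b : W → W → ℝ} (h1 : ∀ v, IsLinearMap ℝ fun u => b u v) (h2 : ∀ u, IsLinearMap ℝ (b u))
    (hb : ∀ u v, |b u v| ≤ C * ‖u‖ * ‖v‖) (hskew : ∀ v, b v v = 0)
    {ℓ : W → ℝ} (hlin : IsLinearMap ℝ ℓ) (hℓ : ∀ v, |ℓ v| ≤ K * ‖v‖) :
    ∃ u, ∀ v, ν * inner ℝ u v + b u v = ℓ v := by
  let A₀ : W →ₗ[ℝ] W →ₗ[ℝ] ℝ := LinearMap.mk₂ ℝ (fun u v => ν * inner ℝ u v + b u v)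
    (fun u u' v => by rw [inner_add_left, (h1 v).map_add]; ring)
    (fun c u v => by rw [inner_smul_left, (h1 v).map_smul]; simp; ring)
    (fun u v v' => by rw [inner_add_right, (h2 u).map_add]; ring)
    (fun c u v => by rw [inner_smul_right, (h2 u).map_smul]; simp; ring)
  let A : W →L[ℝ] W →L[ℝ] ℝ := A₀.mkContinuous₂ (ν + C) fun u v => by
    have e : A₀ u v = ν * inner ℝ u v + b u v := rfl
    rw [e, Real.norm_eq_abs]
    refine (abs_add_le _ _).trans ?_
    rw [abs_mul, abs_of_pos hν]
    have := mul_le_mul_of_nonneg_left (abs_real_inner_le_norm u v) hν.le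
    linarith [hb u v]
  have hA : ∀ u v, A u v = ν * inner ℝ u v + b u v := fun u v => rfl
  have hco : IsCoercive A := ⟨ν, hν, fun u => by
    rw [hA, hskew, real_inner_self_eq_norm_mul_norm, add_zero, mul_assoc]⟩
  let ℓ' : W →L[ℝ] ℝ := (hlin.mk' ℓ).mkContinuous K hℓ
  refine ⟨hco.continuousLinearEquivOfBilin.symm ((InnerProductSpace.toDual ℝ W).symm ℓ'),
    fun v => ?_⟩
  rw [← hA, ← hco.continuousLinearEquivOfBilin_apply, ContinuousLinearEquiv.apply_symm_apply,
    InnerProductSpace.toDual_symm_apply]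
  rfl

/-- Under the smallness condition, `w ↦ u`, where `u` solves the problem linearized at `w`, is a
contraction: testing the difference of two such problems with the difference `e` of their solutions
kills `b(w₁, e, e)` and leaves `ν ‖e‖² = -b(w₁ - w₂, u₂, e)`, where `‖u₂‖ ≤ K / ν`. -/
theorem existsUnique_of_small [CompleteSpace W] {ν K N : ℝ} (hν : 0 < ν) (hN : 0 < N) (hK : 0 ≤ K)
    {b : W → W → W → ℝ} (h1 : ∀ v w, IsLinearMap ℝ fun u => b u v w)
    (h2 : ∀ u w, IsLinearMap ℝ fun v => b u v w) (h3 : ∀ u v, IsLinearMap ℝ (b u v))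
    (hb : ∀ u v w, |b u v w| ≤ N * ‖u‖ * ‖v‖ * ‖w‖) (hskew : ∀ u v, b u v v = 0)
    {ℓ : W → ℝ} (hlin : IsLinearMap ℝ ℓ) (hℓ : ∀ v, |ℓ v| ≤ K * ‖v‖)
    (hsmall : N * K / ν ^ 2 < 1) :
    ∃! u, ∀ v, ν * inner ℝ u v + b u u v = ℓ v := by
  choose T hT using fun w => exists_linearized_solution hν (h2 w) (h3 w) (hb w) (hskew w) hlin hℓ
  have key : ∀ {w₁ w₂ u₁ u₂ : W}, (∀ v, ν * inner ℝ u₁ v + b w₁ u₁ v = ℓ v) →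
      (∀ v, ν * inner ℝ u₂ v + b w₂ u₂ v = ℓ v) →
      ‖u₁ - u₂‖ ≤ N * K / ν ^ 2 * ‖w₁ - w₂‖ := by
    intro w₁ w₂ u₁ u₂ e₁ e₂
    have hu₂ : ‖u₂‖ ≤ K / ν := norm_le_of_energy hν hK (hskew w₂ u₂) (hℓ _) (e₂ _)
    have a := e₁ (u₁ - u₂)
    have a' := e₂ (u₁ - u₂)
    have s := hskew w₁ (u₁ - u₂)
    rw [(h2 w₁ (u₁ - u₂)).map_sub] at s
    have t : b (w₁ - w₂) u₂ (u₁ - u₂) = b w₁ u₂ (u₁ - u₂) - b w₂ u₂ (u₁ - u₂) :=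
      (h1 u₂ (u₁ - u₂)).map_sub w₁ w₂
    have r : ν * ‖u₁ - u₂‖ ^ 2 = -b (w₁ - w₂) u₂ (u₁ - u₂) := by
      have p := inner_sub_left (𝕜 := ℝ) u₁ u₂ (u₁ - u₂)
      rw [← real_inner_self_eq_norm_sq, t, p]
      linarith
    have q : -b (w₁ - w₂) u₂ (u₁ - u₂) ≤ N * ‖w₁ - w₂‖ * (K / ν) * ‖u₁ - u₂‖ := by
      refine (neg_le_abs _).trans ((hb _ _ _).trans ?_)
      gcongr
    rcases eq_or_lt_of_le (norm_nonneg (u₁ - u₂)) with h0 | h0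
    · rw [← h0]; positivity
    · have : ν * ‖u₁ - u₂‖ ≤ N * ‖w₁ - w₂‖ * (K / ν) :=
        le_of_mul_le_mul_right (by rw [← r] at q; linarith) h0
      calc ‖u₁ - u₂‖ ≤ N * ‖w₁ - w₂‖ * (K / ν) / ν := by rw [le_div_iff₀ hν]; linarith
        _ = _ := by field_simp
  have hc : ContractingWith (N * K / ν ^ 2).toNNReal T := by
    refine ⟨by simpa using hsmall, LipschitzWith.of_dist_le_mul fun w₁ w₂ => ?_⟩
    rw [Real.coe_toNNReal _ (by positivity), dist_eq_norm, dist_eq_norm]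
    exact key (hT w₁) (hT w₂)
  have hfix := hc.fixedPoint_isFixedPt
  refine ⟨hc.fixedPoint T, fun v => ?_, fun u hu => ?_⟩
  · have := hT (hc.fixedPoint T) v
    rwa [hfix] at this
  · refine hc.fixedPoint_unique (sub_eq_zero.1 (norm_le_zero_iff.1 ?_))
    have := key (hT u) hu
    simpa using this

/-- The form of `existsUnique_of_small` for a space `U` that carries the energy inner product only
through an injective map `T` with complete range into a Hilbert space. -/
theorem existsUnique_of_small_of_range {U X : Type*} [AddCommGroup U] [Module ℝ U]
    [NormedAddCommGroup X] [InnerProductSpace ℝ X] (T : U →ₗ[ℝ] X) (hinj : Function.Injective T)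
    (hcomp : IsComplete (Set.range T)) {ν K N : ℝ} (hν : 0 < ν) (hN : 0 < N) (hK : 0 ≤ K)
    {b : U → U → U → ℝ} (h1 : ∀ v w, IsLinearMap ℝ fun u => b u v w)
    (h2 : ∀ u w, IsLinearMap ℝ fun v => b u v w) (h3 : ∀ u v, IsLinearMap ℝ (b u v))
    (hb : ∀ u v w, |b u v w| ≤ N * ‖T u‖ * ‖T v‖ * ‖T w‖) (hskew : ∀ u v, b u v v = 0)
    {ℓ : U → ℝ} (hlin : IsLinearMap ℝ ℓ) (hℓ : ∀ v, |ℓ v| ≤ K * ‖T v‖)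
    (hsmall : N * K / ν ^ 2 < 1) :
    ∃! u, ∀ v, ν * inner ℝ (T u) (T v) + b u u v = ℓ v := by
  have : CompleteSpace (LinearMap.range T) := hcomp.completeSpace_coe
  let e : U ≃ₗ[ℝ] LinearMap.range T := LinearEquiv.ofInjective T hinj
  have he : ∀ x, T (e.symm x) = x := fun x => congrArg Subtype.val (e.apply_symm_apply x)
  have hn : ∀ x, ‖T (e.symm x)‖ = ‖x‖ := fun x => by rw [he]; rfl
  have comp : ∀ {g : U → ℝ}, IsLinearMap ℝ g → IsLinearMap ℝ fun x => g (e.symm x) :=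
    fun hg => ⟨fun x y => by rw [map_add, hg.map_add], fun c x => by rw [map_smul, hg.map_smul]⟩
  obtain ⟨x, hx, hx'⟩ := existsUnique_of_small (W := LinearMap.range T) hν hN hK
    (b := fun x y z => b (e.symm x) (e.symm y) (e.symm z)) (fun _ _ => comp (h1 _ _))
    (fun _ _ => comp (h2 _ _)) (fun _ _ => comp (h3 _ _))
    (fun x y z => by simpa only [hn] using hb (e.symm x) (e.symm y) (e.symm z))
    (fun _ _ => hskew _ _) (comp hlin) (fun x => by simpa only [hn] using hℓ (e.symm x)) hsmall
  refine ⟨e.symm x, fun v => ?_, fun u hu => ?_⟩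
  · have := hx (e v)
    rw [e.symm_apply_apply] at this
    rw [← this, he]
    rfl
  · rw [LinearEquiv.eq_symm_apply]
    refine hx' _ fun v => ?_
    have := hu (e.symm v)
    rw [he] at this
    rw [← this, e.symm_apply_apply]
    rfl

end Abstract
variable {d : ℕ} {Ω : Set (EuclideanSpace ℝ (Fin d))}

/-! ### `H¹₀(Ω)` as a closed space of pairs `(u, ∇u)` -/

theorem IsTestFunction.continuous_pderiv {φ : EuclideanSpace ℝ (Fin d) → ℝ}
    (hφ : IsTestFunction Ω φ) (i : Fin d) : Continuous (pderiv i φ) :=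
  (hφ.smooth.continuous_fderiv (by simp)).clm_apply continuous_const

theorem IsTestFunction.hasCompactSupport_pderiv {φ : EuclideanSpace ℝ (Fin d) → ℝ}
    (hφ : IsTestFunction Ω φ) (i : Fin d) : HasCompactSupport (pderiv i φ) :=
  hφ.compact.fderiv_apply ℝ _

theorem IsTestFunction.memLp {φ : EuclideanSpace ℝ (Fin d) → ℝ}
    (hφ : IsTestFunction Ω φ) : MemLp φ 2 (volume.restrict Ω) :=
  hφ.smooth.continuous.memLp_of_hasCompactSupport hφ.compact

theorem IsTestFunction.memLp_pderiv {φ : EuclideanSpace ℝ (Fin d) → ℝ}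
    (hφ : IsTestFunction Ω φ) (i : Fin d) : MemLp (pderiv i φ) 2 (volume.restrict Ω) :=
  (hφ.continuous_pderiv i).memLp_of_hasCompactSupport (hφ.hasCompactSupport_pderiv i)

theorem IsTestFunction.eq_zero {φ : EuclideanSpace ℝ (Fin d) → ℝ}
    (hφ : IsTestFunction Ω φ) {x : EuclideanSpace ℝ (Fin d)} (hx : x ∉ Ω) : φ x = 0 :=
  image_eq_zero_of_notMem_tsupport fun h => hx (hφ.support h)

theorem IsTestFunction.differentiable {φ : EuclideanSpace ℝ (Fin d) → ℝ}
    (hφ : IsTestFunction Ω φ) : Differentiable ℝ φ :=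
  hφ.smooth.differentiable (by simp)

/-- The pairs `(φ, ∇φ)` in `L²(Ω) × L²(Ω)^d` for test functions `φ`. -/
def testGraph (Ω : Set (EuclideanSpace ℝ (Fin d))) : Submodule ℝ (L2 Ω × (Fin d → L2 Ω)) where
  carrier := {p | ∃ φ, IsTestFunction Ω φ ∧ p.1 =ᵐ[volume.restrict Ω] φ ∧
    ∀ i, p.2 i =ᵐ[volume.restrict Ω] pderiv i φ}
  add_mem' := by
    rintro p q ⟨φ, hφ, h1, h2⟩ ⟨ψ, hψ, k1, k2⟩
    refine ⟨φ + ψ, ⟨hφ.smooth.add hψ.smooth, hφ.compact.add hψ.compact,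
      (tsupport_add φ ψ).trans (Set.union_subset hφ.support hψ.support)⟩, ?_, fun i => ?_⟩
    · exact (Lp.coeFn_add _ _).trans (h1.add k1)
    · refine (Lp.coeFn_add _ _).trans (((h2 i).add (k2 i)).trans (Eventually.of_forall fun x => ?_))
      simp [pderiv, fderiv_add (hφ.differentiable x) (hψ.differentiable x)]
  zero_mem' := by
    refine ⟨0, ⟨contDiff_const, HasCompactSupport.zero, by simp⟩, Lp.coeFn_zero _ _ _,
      fun i => (Lp.coeFn_zero _ _ _).trans (Eventually.of_forall fun x => ?_)⟩
    simp [pderiv]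
  smul_mem' := by
    rintro c p ⟨φ, hφ, h1, h2⟩
    refine ⟨c • φ, ⟨contDiff_const.smul hφ.smooth, hφ.compact.smul_left,
      (tsupport_smul_subset_right (fun _ => c) φ).trans hφ.support⟩, ?_, fun i => ?_⟩
    · exact (Lp.coeFn_smul _ _).trans (h1.const_smul c)
    · refine (Lp.coeFn_smul _ _).trans (((h2 i).const_smul c).trans
        (Eventually.of_forall fun x => ?_))
      simp [pderiv, fderiv_const_smul (hφ.differentiable x)]

theorem IsTestFunction.mem_testGraph {φ : EuclideanSpace ℝ (Fin d) → ℝ}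
    (hφ : IsTestFunction Ω φ) :
    ((hφ.memLp.toLp φ, fun i => (hφ.memLp_pderiv i).toLp (pderiv i φ)) :
      L2 Ω × (Fin d → L2 Ω)) ∈ testGraph Ω :=
  ⟨φ, hφ, hφ.memLp.coeFn_toLp, fun i => (hφ.memLp_pderiv i).coeFn_toLp⟩

theorem L2_inner_eq (u v : L2 Ω) : inner ℝ u v = ∫ x in Ω, u x * v x := by
  rw [L2.inner_def]
  exact integral_congr_ae (Eventually.of_forall fun x => by simp [mul_comm])

/-- The defining identity of the weak derivative, as a closed linear condition on the pairs
`(φ, ∇φ)`. -/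
theorem hasWeakPartial_iff_inner {i : Fin d} {u g : L2 Ω} :
    HasWeakPartial Ω i u g ↔ ∀ p ∈ testGraph Ω, inner ℝ u (p.2 i) = - inner ℝ g p.1 := by
  constructor
  · rintro h p ⟨φ, hφ, h1, h2⟩
    rw [L2_inner_eq, L2_inner_eq]
    refine Eq.trans (integral_congr_ae ?_) ((h φ hφ).trans (congrArg _ (integral_congr_ae ?_)))
    · filter_upwards [h2 i] with x hx
      rw [hx]
    · filter_upwards [h1] with x hx
      rw [hx]
  · intro h φ hφ
    have := h _ hφ.mem_testGraph
    rw [L2_inner_eq, L2_inner_eq] at this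
    refine Eq.trans (integral_congr_ae ?_) (this.trans (congrArg _ (integral_congr_ae ?_)))
    · filter_upwards [(hφ.memLp_pderiv i).coeFn_toLp] with x hx
      rw [hx]
    · filter_upwards [hφ.memLp.coeFn_toLp] with x hx
      rw [hx]

/-- Integration by parts against the pairs `(w, ∇w)` with `w ∈ H¹₀(Ω)`. -/
theorem HasWeakPartial.inner_eq {i : Fin d} {u g : L2 Ω} (h : HasWeakPartial Ω i u g)
    {p : L2 Ω × (Fin d → L2 Ω)} (hp : p ∈ (testGraph Ω).topologicalClosure) :
    inner ℝ u (p.2 i) = - inner ℝ g p.1 := by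
  have hcl : IsClosed {p : L2 Ω × (Fin d → L2 Ω) | inner ℝ u (p.2 i) = - inner ℝ g p.1} :=
    isClosed_eq (by fun_prop) (by fun_prop)
  exact closure_minimal (hasWeakPartial_iff_inner.1 h) hcl hp

theorem hasWeakPartial_of_mem_testGraph {p : L2 Ω × (Fin d → L2 Ω)} (hp : p ∈ testGraph Ω)
    (i : Fin d) : HasWeakPartial Ω i p.1 (p.2 i) := by
  obtain ⟨φ, hφ, h1, h2⟩ := hp
  intro ψ hψ
  have e1 : ∫ x in Ω, p.1 x * pderiv i ψ x = ∫ x, φ x * pderiv i ψ x := by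
    rw [← setIntegral_eq_integral_of_forall_compl_eq_zero (s := Ω) (f := fun x => φ x * pderiv i ψ x)
      fun x hx => by rw [hφ.eq_zero hx, zero_mul]]
    refine integral_congr_ae ?_
    filter_upwards [h1] with x hx
    rw [hx]
  have e2 : ∫ x in Ω, p.2 i x * ψ x = ∫ x, pderiv i φ x * ψ x := by
    rw [← setIntegral_eq_integral_of_forall_compl_eq_zero (s := Ω) (f := fun x => pderiv i φ x * ψ x)
      fun x hx => by rw [hψ.eq_zero hx, mul_zero]]
    refine integral_congr_ae ?_
    filter_upwards [h2 i] with x hx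
    rw [hx]
  rw [e1, e2]
  refine integral_mul_fderiv_eq_neg_fderiv_mul_of_integrable ?_ ?_ ?_
    (fun x _ => hφ.differentiable x) (fun x _ => hψ.differentiable x)
  · exact ((hφ.continuous_pderiv i).mul hψ.smooth.continuous).integrable_of_hasCompactSupport
      hψ.compact.mul_left
  · exact (hφ.smooth.continuous.mul (hψ.continuous_pderiv i)).integrable_of_hasCompactSupport
      hφ.compact.mul_right
  · exact (hφ.smooth.continuous.mul hψ.smooth.continuous).integrable_of_hasCompactSupport
      hφ.compact.mul_right

/-- Limits of the pairs `(φ, ∇φ)` are pairs of a function and its weak gradient: testing with `q`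
is `HasWeakPartial.inner_eq` with the roles of the two functions exchanged. -/
theorem hasWeakPartial_of_mem_closure {p : L2 Ω × (Fin d → L2 Ω)}
    (hp : p ∈ (testGraph Ω).topologicalClosure) (i : Fin d) : HasWeakPartial Ω i p.1 (p.2 i) := by
  refine hasWeakPartial_iff_inner.2 fun q hq => ?_
  have := (hasWeakPartial_of_mem_testGraph hq i).inner_eq hp
  rw [real_inner_comm, real_inner_comm q.1, this, neg_neg]

theorem weakPartial_eq (hΩ : IsOpen Ω) {i : Fin d} {u g : L2 Ω} (h : HasWeakPartial Ω i u g) :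
    weakPartial Ω i u = g := by
  have hex : ∃ g, HasWeakPartial Ω i u g := ⟨g, h⟩
  rw [weakPartial, dif_pos hex]
  exact hex.choose_spec.unique hΩ h

theorem weakPartial_eq_of_mem_closure (hΩ : IsOpen Ω) {p : L2 Ω × (Fin d → L2 Ω)}
    (hp : p ∈ (testGraph Ω).topologicalClosure) (i : Fin d) : weakPartial Ω i p.1 = p.2 i :=
  weakPartial_eq hΩ (hasWeakPartial_of_mem_closure hp i)

/-- `H¹₀(Ω)` consists of the `u` whose pair `(u, ∇u)` is a limit of pairs `(φ, ∇φ)`. -/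
theorem memH10_iff {u : L2 Ω} : MemH10 Ω u ↔
    (u, fun i => weakPartial Ω i u) ∈ (testGraph Ω).topologicalClosure := by
  rw [← SetLike.mem_coe, Submodule.topologicalClosure_coe, mem_closure_iff_seq_limit]
  constructor
  · rintro ⟨-, φ, hφ, h1, h2⟩
    refine ⟨_, fun n => (hφ n).mem_testGraph, ?_⟩
    rw [Prod.tendsto_iff, tendsto_pi_nhds]
    refine ⟨?_, fun i => ?_⟩
    · rw [Lp.tendsto_Lp_iff_tendsto_eLpNorm']
      refine h1.congr fun n => eLpNorm_congr_ae ?_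
      filter_upwards [(hφ n).memLp.coeFn_toLp] with x hx
      simp [hx]
    · rw [Lp.tendsto_Lp_iff_tendsto_eLpNorm']
      refine (h2 i).congr fun n => eLpNorm_congr_ae ?_
      filter_upwards [((hφ n).memLp_pderiv i).coeFn_toLp] with x hx
      simp [hx]
  · rintro ⟨p, hp, hlim⟩
    have hcl : (u, fun i => weakPartial Ω i u) ∈ (testGraph Ω).topologicalClosure := by
      rw [← SetLike.mem_coe, Submodule.topologicalClosure_coe, mem_closure_iff_seq_limit]
      exact ⟨p, hp, hlim⟩
    refine ⟨fun i => ⟨_, hasWeakPartial_of_mem_closure hcl i⟩, ?_⟩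
    choose φ hφ h1 h2 using hp
    rw [Prod.tendsto_iff, tendsto_pi_nhds] at hlim
    refine ⟨φ, hφ, ?_, fun i => ?_⟩
    · refine ((Lp.tendsto_Lp_iff_tendsto_eLpNorm' _ _).1 hlim.1).congr fun n => eLpNorm_congr_ae ?_
      filter_upwards [h1 n] with x hx
      simp [hx]
    · refine ((Lp.tendsto_Lp_iff_tendsto_eLpNorm' _ _).1 (hlim.2 i)).congr
        fun n => eLpNorm_congr_ae ?_
      filter_upwards [h2 n i] with x hx
      simp [hx]

theorem memH10_of_mem_closure (hΩ : IsOpen Ω) {p : L2 Ω × (Fin d → L2 Ω)}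
    (hp : p ∈ (testGraph Ω).topologicalClosure) : MemH10 Ω p.1 := by
  rw [memH10_iff]
  convert hp
  exact weakPartial_eq_of_mem_closure hΩ hp _

theorem MemH10.add (hΩ : IsOpen Ω) {u v : L2 Ω} (hu : MemH10 Ω u) (hv : MemH10 Ω v) :
    MemH10 Ω (u + v) :=
  memH10_of_mem_closure hΩ (add_mem ((memH10_iff).1 hu) ((memH10_iff).1 hv))

theorem MemH10.smul (hΩ : IsOpen Ω) {u : L2 Ω} (hu : MemH10 Ω u) (c : ℝ) :
    MemH10 Ω (c • u) :=
  memH10_of_mem_closure hΩ (Submodule.smul_mem _ c ((memH10_iff).1 hu))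

theorem weakPartial_add (hΩ : IsOpen Ω) {u v : L2 Ω} (hu : MemH10 Ω u) (hv : MemH10 Ω v)
    (i : Fin d) : weakPartial Ω i (u + v) = weakPartial Ω i u + weakPartial Ω i v :=
  weakPartial_eq_of_mem_closure hΩ (add_mem ((memH10_iff).1 hu) ((memH10_iff).1 hv)) i

theorem weakPartial_smul (hΩ : IsOpen Ω) {u : L2 Ω} (hu : MemH10 Ω u) (c : ℝ)
    (i : Fin d) : weakPartial Ω i (c • u) = c • weakPartial Ω i u :=
  weakPartial_eq_of_mem_closure hΩ (Submodule.smul_mem _ c ((memH10_iff).1 hu)) i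

/-! ### The embedding `H¹₀(Ω) ⊆ L⁴(Ω)` -/

theorem norm_fderiv_le_sum_pderiv (φ : EuclideanSpace ℝ (Fin d) → ℝ)
    (x : EuclideanSpace ℝ (Fin d)) : ‖fderiv ℝ φ x‖ ≤ ∑ i, ‖pderiv i φ x‖ := by
  refine ContinuousLinearMap.opNorm_le_bound _ (Finset.sum_nonneg fun _ _ => norm_nonneg _)
    fun y => ?_
  have hy : y = ∑ i, y i • EuclideanSpace.single i (1 : ℝ) := by
    simpa using ((EuclideanSpace.basisFun (Fin d) ℝ).sum_repr y).symm
  conv_lhs => rw [hy]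
  rw [map_sum, Finset.sum_mul]
  refine (norm_sum_le _ _).trans (Finset.sum_le_sum fun i _ => ?_)
  rw [map_smul, norm_smul, mul_comm]
  exact mul_le_mul_of_nonneg_left (PiLp.norm_apply_le y i) (norm_nonneg _)

theorem eLpNorm_fderiv_le_sum_pderiv {φ : EuclideanSpace ℝ (Fin d) → ℝ}
    (hφ : IsTestFunction Ω φ) : eLpNorm (fderiv ℝ φ) 2 (volume.restrict Ω) ≤
      ∑ i, eLpNorm (pderiv i φ) 2 (volume.restrict Ω) := by
  calc eLpNorm (fderiv ℝ φ) 2 (volume.restrict Ω)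
      ≤ eLpNorm (∑ i, fun x => ‖pderiv i φ x‖) 2 (volume.restrict Ω) :=
        eLpNorm_mono_real fun x => by
          rw [Finset.sum_apply]
          exact norm_fderiv_le_sum_pderiv φ x
    _ ≤ ∑ i, eLpNorm (fun x => ‖pderiv i φ x‖) 2 (volume.restrict Ω) :=
        eLpNorm_sum_le (fun i _ => (hφ.continuous_pderiv i).norm.aestronglyMeasurable)
          (by norm_num)
    _ = _ := by simp_rw [eLpNorm_norm]

theorem IsTestFunction.eLpNorm_fderiv_restrict {φ : EuclideanSpace ℝ (Fin d) → ℝ}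
    (hφ : IsTestFunction Ω φ) (p : ENNReal) :
    eLpNorm (fderiv ℝ φ) p (volume.restrict Ω) = eLpNorm (fderiv ℝ φ) p volume := by
  rw [← eLpNorm_norm (μ := volume.restrict Ω) (fderiv ℝ φ),
    ← eLpNorm_norm (μ := volume) (fderiv ℝ φ)]
  refine eLpNorm_restrict_eq_of_support_subset (f := fun x => ‖fderiv ℝ φ x‖) fun x hx => ?_
  exact hφ.support (tsupport_fderiv_subset ℝ (subset_tsupport _ (norm_ne_zero_iff.1 hx)))

/-- The Gagliardo–Nirenberg–Sobolev inequality with `1/4 = 1/p - 1/d`, followed by Hölder's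
inequality on the bounded set `Ω`, which is possible because `p = 4d/(d+4) ≤ 2`. -/
theorem exists_eLpNorm_four_le_of_isTestFunction (hd : d = 2 ∨ d = 3)
    (hbdd : Bornology.IsBounded Ω) : ∃ C : ℝ, 0 ≤ C ∧ ∀ φ, IsTestFunction Ω φ →
      eLpNorm φ 4 (volume.restrict Ω) ≤
        ENNReal.ofReal C * ∑ i, eLpNorm (pderiv i φ) 2 (volume.restrict Ω) := by
  obtain ⟨p, hp1, hp2, hp⟩ : ∃ p : NNReal, 1 ≤ p ∧ p ≤ 2 ∧
      (((4 : NNReal) : ℝ))⁻¹ = (p : ℝ)⁻¹ - (d : ℝ)⁻¹ := by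
    rcases hd with rfl | rfl
    · refine ⟨4 / 3, ?_, ?_, ?_⟩
      · rw [← NNReal.coe_le_coe]; norm_num
      · rw [← NNReal.coe_le_coe]; norm_num
      · norm_num
    · refine ⟨12 / 7, ?_, ?_, ?_⟩
      · rw [← NNReal.coe_le_coe]; norm_num
      · rw [← NNReal.coe_le_coe]; norm_num
      · norm_num
  set c : NNReal := eLpNormLESNormFDerivOfEqInnerConst
    (volume : Measure (EuclideanSpace ℝ (Fin d))) p
  set M : ENNReal :=
    (volume.restrict Ω) Set.univ ^ (1 / (p : ENNReal).toReal - 1 / (2 : ENNReal).toReal)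
  have hM : M ≠ ⊤ := by
    refine ENNReal.rpow_ne_top_of_nonneg ?_ ?_
    · have : (1 : ℝ) ≤ p := by exact_mod_cast hp1
      have h2 : (p : ℝ) ≤ 2 := by exact_mod_cast hp2
      simp only [ENNReal.coe_toReal, ENNReal.toReal_ofNat, one_div, sub_nonneg]
      exact inv_anti₀ (by linarith) h2
    · rw [Measure.restrict_apply_univ]
      exact hbdd.measure_lt_top.ne
  refine ⟨(c * M).toReal, ENNReal.toReal_nonneg, fun φ hφ => ?_⟩
  rw [ENNReal.ofReal_toReal (ENNReal.mul_ne_top ENNReal.coe_ne_top hM)]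
  have hcont : Continuous (fderiv ℝ φ) := hφ.smooth.continuous_fderiv (by simp)
  calc eLpNorm φ 4 (volume.restrict Ω) ≤ eLpNorm φ 4 volume := eLpNorm_restrict_le _ _ _ _
    _ ≤ c * eLpNorm (fderiv ℝ φ) p volume := by
        refine eLpNorm_le_eLpNorm_fderiv_of_eq_inner (p' := 4) volume (hφ.smooth.of_le (by simp))
          hφ.compact hp1 ?_ ?_
        · rw [finrank_euclideanSpace_fin]; omega
        · rw [finrank_euclideanSpace_fin, hp, NNReal.coe_inv]
    _ = c * eLpNorm (fderiv ℝ φ) p (volume.restrict Ω) := by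
        rw [hφ.eLpNorm_fderiv_restrict]
    _ ≤ c * (eLpNorm (fderiv ℝ φ) 2 (volume.restrict Ω) * M) := by
        gcongr
        exact eLpNorm_le_eLpNorm_mul_rpow_measure_univ (by exact_mod_cast hp2)
          hcont.aestronglyMeasurable
    _ ≤ c * ((∑ i, eLpNorm (pderiv i φ) 2 (volume.restrict Ω)) * M) := by
        gcongr
        exact eLpNorm_fderiv_le_sum_pderiv hφ
    _ = _ := by ring

/-- The embedding `H¹₀(Ω) ⊆ L⁴(Ω)`; the bound passes from test functions to the limit by Fatou's
lemma along an almost everywhere convergent subsequence. -/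
theorem exists_eLpNorm_four_le (hd : d = 2 ∨ d = 3) (hbdd : Bornology.IsBounded Ω) :
    ∃ C : ℝ, 0 ≤ C ∧ ∀ p : L2 Ω × (Fin d → L2 Ω), p ∈ (testGraph Ω).topologicalClosure →
      eLpNorm p.1 4 (volume.restrict Ω) ≤ ENNReal.ofReal (C * ∑ i, ‖p.2 i‖) := by
  obtain ⟨C, hC, h⟩ := exists_eLpNorm_four_le_of_isTestFunction hd hbdd
  refine ⟨C, hC, fun p hp => ?_⟩
  rw [← SetLike.mem_coe, Submodule.topologicalClosure_coe, mem_closure_iff_seq_limit] at hp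
  obtain ⟨q, hq, hlim⟩ := hp
  have hbound : ∀ n, eLpNorm (q n).1 4 (volume.restrict Ω) ≤
      ENNReal.ofReal (C * ∑ i, ‖(q n).2 i‖) := by
    intro n
    obtain ⟨φ, hφ, h1, h2⟩ := hq n
    rw [eLpNorm_congr_ae h1, ENNReal.ofReal_mul hC, ENNReal.ofReal_sum_of_nonneg
      fun _ _ => norm_nonneg _]
    refine (h φ hφ).trans_eq ?_
    congr 1
    refine Finset.sum_congr rfl fun i _ => ?_
    rw [← eLpNorm_congr_ae (h2 i), Lp.norm_def, ENNReal.ofReal_toReal (Lp.eLpNorm_ne_top _)]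
  have hR : Tendsto (fun n => C * ∑ i, ‖(q n).2 i‖) atTop (𝓝 (C * ∑ i, ‖p.2 i‖)) := by
    have : Continuous fun p : L2 Ω × (Fin d → L2 Ω) => C * ∑ i, ‖p.2 i‖ := by fun_prop
    exact (this.tendsto p).comp hlim
  have hmeas := tendstoInMeasure_of_tendsto_Lp ((Prod.tendsto_iff _ _).1 hlim).1
  have hε : ∀ ε : ℝ, 0 < ε →
      eLpNorm p.1 4 (volume.restrict Ω) ≤ ENNReal.ofReal (C * ∑ i, ‖p.2 i‖ + ε) := by
    intro ε hε
    refine eLpNorm_le_of_tendstoInMeasure ?_ hmeas fun n => Lp.aestronglyMeasurable _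
    filter_upwards [hR.eventually_le_const (lt_add_of_pos_right _ hε)] with n hn
    exact (hbound n).trans (ENNReal.ofReal_le_ofReal hn)
  refine ENNReal.le_of_forall_pos_le_add fun ε hε0 _ => ?_
  refine (hε ε hε0).trans (ENNReal.ofReal_add_le.trans_eq ?_)
  rw [ENNReal.ofReal_coe_nnreal]

/-- The Poincaré inequality on `H¹₀(Ω)`, read off from the `L⁴` bound since `Ω` is bounded. -/
theorem exists_norm_le (hd : d = 2 ∨ d = 3) (hbdd : Bornology.IsBounded Ω) :
    ∃ C : ℝ, 0 ≤ C ∧ ∀ p : L2 Ω × (Fin d → L2 Ω), p ∈ (testGraph Ω).topologicalClosure →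
      ‖p.1‖ ≤ C * ∑ i, ‖p.2 i‖ := by
  obtain ⟨C, hC, h⟩ := exists_eLpNorm_four_le hd hbdd
  set M : ENNReal :=
    (volume.restrict Ω) Set.univ ^ (1 / (2 : ENNReal).toReal - 1 / (4 : ENNReal).toReal)
  have hM : M ≠ ⊤ := by
    refine ENNReal.rpow_ne_top_of_nonneg (by norm_num) ?_
    rw [Measure.restrict_apply_univ]
    exact hbdd.measure_lt_top.ne
  refine ⟨C * M.toReal, by positivity, fun p hp => ?_⟩
  have h0 : 0 ≤ C * ∑ i, ‖p.2 i‖ := by positivity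
  have key : eLpNorm p.1 2 (volume.restrict Ω) ≤ ENNReal.ofReal (C * ∑ i, ‖p.2 i‖) * M :=
    (eLpNorm_le_eLpNorm_mul_rpow_measure_univ (by norm_num) (Lp.aestronglyMeasurable _)).trans
      (mul_le_mul_left (h p hp) M)
  rw [Lp.norm_def]
  refine (ENNReal.toReal_mono (ENNReal.mul_ne_top ENNReal.ofReal_ne_top hM) key).trans_eq ?_
  rw [ENNReal.toReal_mul, ENNReal.toReal_ofReal h0]
  ring

/-! ### The rotational form -/

instance holderTriple_four_four_two : ENNReal.HolderTriple 4 4 2 where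
  inv_add_inv_eq_inv := by
    rw [show (4 : ENNReal) = 2 * 2 by norm_num, ENNReal.mul_inv (by simp) (by simp), ← mul_add,
      ENNReal.inv_two_add_inv_two, mul_one]

/-- `∫_Ω g a b`, the building block of the rotational form. -/
noncomputable def tripleIntegral (Ω : Set (EuclideanSpace ℝ (Fin d))) (g a b : L2 Ω) : ℝ :=
  ∫ x in Ω, g x * (a x * b x)

theorem integrable_triple (g : L2 Ω) {a b : L2 Ω} (ha : MemLp a 4 (volume.restrict Ω))
    (hb : MemLp b 4 (volume.restrict Ω)) :
    Integrable (fun x => g x * (a x * b x)) (volume.restrict Ω) :=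
  (Lp.memLp g).integrable_mul (q := 2) (hb.mul (r := 2) ha)

theorem eLpNorm_fun_mul_le {α : Type*} [MeasurableSpace α] {μ : Measure α} {p q r : ENNReal}
    [ENNReal.HolderTriple p q r] {f g : α → ℝ} (hf : AEStronglyMeasurable f μ)
    (hg : AEStronglyMeasurable g μ) :
    eLpNorm (fun x => f x * g x) r μ ≤ eLpNorm f p μ * eLpNorm g q μ :=
  eLpNorm_le_eLpNorm_mul_eLpNorm_of_nnnorm (p := p) (q := q) hf hg (fun s t => s * t) 1
    (.of_forall fun x => by simp) |>.trans_eq (by simp)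

theorem abs_tripleIntegral_le (g : L2 Ω) {a b : L2 Ω} {A B : ℝ} (hA : 0 ≤ A) (hB : 0 ≤ B)
    (ha : eLpNorm a 4 (volume.restrict Ω) ≤ ENNReal.ofReal A)
    (hb : eLpNorm b 4 (volume.restrict Ω) ≤ ENNReal.ofReal B) :
    |tripleIntegral Ω g a b| ≤ ‖g‖ * (A * B) := by
  have h1 : eLpNorm (fun x => a x * b x) 2 (volume.restrict Ω) ≤
      ENNReal.ofReal A * ENNReal.ofReal B :=
    (eLpNorm_fun_mul_le (p := 4) (q := 4) (Lp.aestronglyMeasurable a)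
      (Lp.aestronglyMeasurable b)).trans (mul_le_mul' ha hb)
  have h2 : eLpNorm (fun x => g x * (a x * b x)) 1 (volume.restrict Ω) ≤
      eLpNorm g 2 (volume.restrict Ω) * eLpNorm (fun x => a x * b x) 2 (volume.restrict Ω) :=
    eLpNorm_fun_mul_le (p := 2) (q := 2) (g := fun x => a x * b x) (Lp.aestronglyMeasurable g)
      ((Lp.aestronglyMeasurable a).mul (Lp.aestronglyMeasurable b))
  have h3 : ‖tripleIntegral Ω g a b‖ₑ ≤ ENNReal.ofReal (‖g‖ * (A * B)) := by
    refine (enorm_integral_le_lintegral_enorm _).trans ?_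
    rw [← eLpNorm_one_eq_lintegral_enorm, ENNReal.ofReal_mul (norm_nonneg _),
      ENNReal.ofReal_mul hA, Lp.norm_def, ENNReal.ofReal_toReal (Lp.eLpNorm_ne_top _)]
    exact h2.trans (mul_le_mul' le_rfl h1)
  rwa [Real.enorm_eq_ofReal_abs, ENNReal.ofReal_le_ofReal_iff (by positivity)] at h3

theorem tripleIntegral_comm (g a b : L2 Ω) : tripleIntegral Ω g a b = tripleIntegral Ω g b a := by
  simp_rw [tripleIntegral, mul_comm]

theorem tripleIntegral_add_left (g g' : L2 Ω) {a b : L2 Ω} (ha : MemLp a 4 (volume.restrict Ω))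
    (hb : MemLp b 4 (volume.restrict Ω)) :
    tripleIntegral Ω (g + g') a b = tripleIntegral Ω g a b + tripleIntegral Ω g' a b := by
  rw [tripleIntegral, tripleIntegral, tripleIntegral,
    ← integral_add (integrable_triple g ha hb) (integrable_triple g' ha hb)]
  refine integral_congr_ae ?_
  filter_upwards [Lp.coeFn_add g g'] with x hx
  rw [hx, Pi.add_apply, add_mul]

theorem tripleIntegral_smul_left (c : ℝ) (g a b : L2 Ω) :
    tripleIntegral Ω (c • g) a b = c * tripleIntegral Ω g a b := by
  rw [tripleIntegral, tripleIntegral, ← integral_const_mul]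
  refine integral_congr_ae ?_
  filter_upwards [Lp.coeFn_smul c g] with x hx
  rw [hx, Pi.smul_apply, smul_eq_mul, mul_assoc]

theorem tripleIntegral_add_mid (g : L2 Ω) {a a' b : L2 Ω} (ha : MemLp a 4 (volume.restrict Ω))
    (ha' : MemLp a' 4 (volume.restrict Ω)) (hb : MemLp b 4 (volume.restrict Ω)) :
    tripleIntegral Ω g (a + a') b = tripleIntegral Ω g a b + tripleIntegral Ω g a' b := by
  rw [tripleIntegral, tripleIntegral, tripleIntegral,
    ← integral_add (integrable_triple g ha hb) (integrable_triple g ha' hb)]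
  refine integral_congr_ae ?_
  filter_upwards [Lp.coeFn_add a a'] with x hx
  rw [hx, Pi.add_apply]
  ring

theorem tripleIntegral_smul_mid (c : ℝ) (g a b : L2 Ω) :
    tripleIntegral Ω g (c • a) b = c * tripleIntegral Ω g a b := by
  rw [tripleIntegral, tripleIntegral, ← integral_const_mul]
  refine integral_congr_ae ?_
  filter_upwards [Lp.coeFn_smul c a] with x hx
  rw [hx, Pi.smul_apply, smul_eq_mul]
  ring

theorem tripleIntegral_add_right (g : L2 Ω) {a b b' : L2 Ω} (ha : MemLp a 4 (volume.restrict Ω))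
    (hb : MemLp b 4 (volume.restrict Ω)) (hb' : MemLp b' 4 (volume.restrict Ω)) :
    tripleIntegral Ω g a (b + b') = tripleIntegral Ω g a b + tripleIntegral Ω g a b' := by
  rw [tripleIntegral_comm, tripleIntegral_add_mid g hb hb' ha, tripleIntegral_comm,
    tripleIntegral_comm g b']

theorem tripleIntegral_smul_right (c : ℝ) (g a b : L2 Ω) :
    tripleIntegral Ω g a (c • b) = c * tripleIntegral Ω g a b := by
  rw [tripleIntegral_comm, tripleIntegral_smul_mid, tripleIntegral_comm]

/-- In both dimensions `(curl u) × v = (∇u - ∇uᵀ) v`. -/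
theorem sum_curlCross_mul (hd : d = 2 ∨ d = 3) (G : Fin d → Fin d → ℝ) (v w : Fin d → ℝ) :
    ∑ k, curlCross d G v k * w k =
      ∑ i, ∑ j, (G i j * (v j * w i) - G i j * (v i * w j)) := by
  rcases hd with rfl | rfl
  · simp [curlCross, Fin.sum_univ_two]
    ring
  · simp [curlCross, Fin.sum_univ_three, crossProduct]
    ring

theorem rotIntegrand_eq (hd : d = 2 ∨ d = 3) (u v w : L2Vec Ω) :
    rotIntegrand Ω u v w = fun x => ∑ i, ∑ j, (weakPartial Ω j (u i) x * (v j x * w i x) -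
      weakPartial Ω j (u i) x * (v i x * w j x)) :=
  funext fun _ => sum_curlCross_mul hd _ _ _

/-- The components of a vector field lie in `L⁴(Ω)`. -/
def MemL4 (v : L2Vec Ω) : Prop := ∀ i, MemLp (v i) 4 (volume.restrict Ω)

theorem integrable_rotIntegrand (hd : d = 2 ∨ d = 3) (u : L2Vec Ω) {v w : L2Vec Ω}
    (hv : MemL4 v) (hw : MemL4 w) :
    Integrable (rotIntegrand Ω u v w) (volume.restrict Ω) := by
  rw [rotIntegrand_eq hd]
  exact integrable_finsetSum _ fun i _ => integrable_finsetSum _ fun j _ =>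
    (integrable_triple _ (hv j) (hw i)).sub (integrable_triple _ (hv i) (hw j))

theorem aRot_eq (hd : d = 2 ∨ d = 3) (u : L2Vec Ω) {v w : L2Vec Ω} (hv : MemL4 v) (hw : MemL4 w) :
    aRot Ω u v w = ∑ i, ∑ j, (tripleIntegral Ω (weakPartial Ω j (u i)) (v j) (w i) -
      tripleIntegral Ω (weakPartial Ω j (u i)) (v i) (w j)) := by
  have h : ∀ i j, Integrable (fun x => weakPartial Ω j (u i) x * (v j x * w i x) -
      weakPartial Ω j (u i) x * (v i x * w j x)) (volume.restrict Ω) := fun i j =>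
    (integrable_triple _ (hv j) (hw i)).sub (integrable_triple _ (hv i) (hw j))
  rw [aRot, rotIntegrand_eq hd, integral_finsetSum _ fun i _ =>
    integrable_finsetSum _ fun j _ => h i j]
  refine Finset.sum_congr rfl fun i _ => ?_
  rw [integral_finsetSum _ fun j _ => h i j]
  exact Finset.sum_congr rfl fun j _ =>
    integral_sub (integrable_triple _ (hv j) (hw i)) (integrable_triple _ (hv i) (hw j))

/-- The convecting term does no work: `∇u - ∇uᵀ` is antisymmetric. -/
theorem aRot_self_right (hd : d = 2 ∨ d = 3) (u v : L2Vec Ω) : aRot Ω u v v = 0 := by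
  rw [aRot, rotIntegrand_eq hd, ← integral_zero (EuclideanSpace ℝ (Fin d)) ℝ]
  congr 1
  funext x
  simp_rw [Finset.sum_sub_distrib]
  rw [sub_eq_zero]
  exact Finset.sum_congr rfl fun i _ => Finset.sum_congr rfl fun j _ => by rw [mul_comm (v j x)]

theorem MemL4.add {v w : L2Vec Ω} (hv : MemL4 v) (hw : MemL4 w) : MemL4 (v + w) := fun i =>
  ((hv i).add (hw i)).ae_eq (Lp.coeFn_add _ _).symm

theorem MemL4.smul {v : L2Vec Ω} (hv : MemL4 v) (c : ℝ) : MemL4 (c • v) := fun i =>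
  ((hv i).const_smul c).ae_eq (Lp.coeFn_smul _ _).symm

theorem aRot_add_left (hd : d = 2 ∨ d = 3) (hΩ : IsOpen Ω) {u u' v w : L2Vec Ω} (hu : MemV Ω u)
    (hu' : MemV Ω u') (hv : MemL4 v) (hw : MemL4 w) :
    aRot Ω (u + u') v w = aRot Ω u v w + aRot Ω u' v w := by
  simp_rw [aRot_eq hd _ hv hw, ← Finset.sum_add_distrib, PiLp.add_apply]
  refine Finset.sum_congr rfl fun i _ => Finset.sum_congr rfl fun j _ => ?_
  rw [weakPartial_add hΩ (hu i) (hu' i), tripleIntegral_add_left _ _ (hv j) (hw i),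
    tripleIntegral_add_left _ _ (hv i) (hw j)]
  ring

theorem aRot_smul_left (hd : d = 2 ∨ d = 3) (hΩ : IsOpen Ω) (c : ℝ) {u v w : L2Vec Ω}
    (hu : MemV Ω u) (hv : MemL4 v) (hw : MemL4 w) :
    aRot Ω (c • u) v w = c * aRot Ω u v w := by
  simp_rw [aRot_eq hd _ hv hw, Finset.mul_sum, PiLp.smul_apply]
  refine Finset.sum_congr rfl fun i _ => Finset.sum_congr rfl fun j _ => ?_
  rw [weakPartial_smul hΩ (hu i), tripleIntegral_smul_left, tripleIntegral_smul_left]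
  ring

theorem aRot_add_mid (hd : d = 2 ∨ d = 3) (u : L2Vec Ω) {v v' w : L2Vec Ω} (hv : MemL4 v)
    (hv' : MemL4 v') (hw : MemL4 w) :
    aRot Ω u (v + v') w = aRot Ω u v w + aRot Ω u v' w := by
  rw [aRot_eq hd _ (hv.add hv') hw, aRot_eq hd _ hv hw, aRot_eq hd _ hv' hw]
  simp_rw [← Finset.sum_add_distrib, PiLp.add_apply]
  refine Finset.sum_congr rfl fun i _ => Finset.sum_congr rfl fun j _ => ?_
  rw [tripleIntegral_add_mid _ (hv j) (hv' j) (hw i),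
    tripleIntegral_add_mid _ (hv i) (hv' i) (hw j)]
  ring

theorem aRot_smul_mid (hd : d = 2 ∨ d = 3) (c : ℝ) (u : L2Vec Ω) {v w : L2Vec Ω} (hv : MemL4 v)
    (hw : MemL4 w) : aRot Ω u (c • v) w = c * aRot Ω u v w := by
  rw [aRot_eq hd _ (hv.smul c) hw, aRot_eq hd _ hv hw]
  simp_rw [Finset.mul_sum, PiLp.smul_apply, tripleIntegral_smul_mid, mul_sub]

theorem aRot_add_right (hd : d = 2 ∨ d = 3) (u : L2Vec Ω) {v w w' : L2Vec Ω} (hv : MemL4 v)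
    (hw : MemL4 w) (hw' : MemL4 w') :
    aRot Ω u v (w + w') = aRot Ω u v w + aRot Ω u v w' := by
  rw [aRot_eq hd _ hv (hw.add hw'), aRot_eq hd _ hv hw, aRot_eq hd _ hv hw']
  simp_rw [← Finset.sum_add_distrib, PiLp.add_apply]
  refine Finset.sum_congr rfl fun i _ => Finset.sum_congr rfl fun j _ => ?_
  rw [tripleIntegral_add_right _ (hv j) (hw i) (hw' i),
    tripleIntegral_add_right _ (hv i) (hw j) (hw' j)]
  ring

theorem aRot_smul_right (hd : d = 2 ∨ d = 3) (c : ℝ) (u : L2Vec Ω) {v w : L2Vec Ω} (hv : MemL4 v)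
    (hw : MemL4 w) : aRot Ω u v (c • w) = c * aRot Ω u v w := by
  rw [aRot_eq hd _ hv (hw.smul c), aRot_eq hd _ hv hw]
  simp_rw [Finset.mul_sum, PiLp.smul_apply, tripleIntegral_smul_right, mul_sub]

/-! ### The energy form, and the constants of the two inequalities -/

/-- The gradient `(∂ⱼ vᵢ)` of a vector field, indexed by the pairs `(i, j)`. -/
noncomputable def gradient (Ω : Set (EuclideanSpace ℝ (Fin d))) (v : L2Vec Ω) :
    PiLp 2 fun _ : Fin d × Fin d => L2 Ω :=
  WithLp.toLp 2 fun ij => weakPartial Ω ij.2 (v ij.1)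

/-- This holds for all fields in `L²(Ω)^d`, since `weakPartial` always takes values in `L²(Ω)`. -/
theorem aForm_eq_inner (v w : L2Vec Ω) :
    aForm Ω v w = inner ℝ (gradient Ω v) (gradient Ω w) := by
  have h : ∀ i j, Integrable (fun x => weakPartial Ω j (v i) x * weakPartial Ω j (w i) x)
      (volume.restrict Ω) := fun i j => (Lp.memLp _).integrable_mul (Lp.memLp _)
  rw [aForm, PiLp.inner_apply, Fintype.sum_prod_type,
    integral_finsetSum _ fun i _ => integrable_finsetSum _ fun j _ => h i j]
  refine Finset.sum_congr rfl fun i _ => ?_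
  rw [integral_finsetSum _ fun j _ => h i j]
  exact Finset.sum_congr rfl fun j _ => (L2_inner_eq _ _).symm

theorem seminormV_eq_norm (v : L2Vec Ω) : seminormV Ω v = ‖gradient Ω v‖ := by
  rw [seminormV, aForm_eq_inner, real_inner_self_eq_norm_sq, Real.sqrt_sq (norm_nonneg _)]

theorem norm_weakPartial_le (v : L2Vec Ω) (i j : Fin d) :
    ‖weakPartial Ω j (v i)‖ ≤ seminormV Ω v := by
  rw [seminormV_eq_norm]
  exact PiLp.norm_apply_le (gradient Ω v) (i, j)

theorem sum_norm_weakPartial_le (v : L2Vec Ω) (i : Fin d) :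
    ∑ j, ‖weakPartial Ω j (v i)‖ ≤ d * seminormV Ω v := by
  refine (Finset.sum_le_sum fun j _ => norm_weakPartial_le v i j).trans_eq ?_
  simp

theorem seminormV_nonneg (v : L2Vec Ω) : 0 ≤ seminormV Ω v := Real.sqrt_nonneg _

theorem exists_eLpNorm_four_le_seminormV (hd : d = 2 ∨ d = 3)
    (hbdd : Bornology.IsBounded Ω) : ∃ C : ℝ, 0 ≤ C ∧ ∀ v : L2Vec Ω, MemV Ω v → ∀ i,
      eLpNorm (v i) 4 (volume.restrict Ω) ≤ ENNReal.ofReal (C * seminormV Ω v) := by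
  obtain ⟨C, hC, h⟩ := exists_eLpNorm_four_le hd hbdd
  refine ⟨C * d, by positivity, fun v hv i => (h _ (memH10_iff.1 (hv i))).trans ?_⟩
  rw [mul_assoc]
  exact ENNReal.ofReal_le_ofReal (mul_le_mul_of_nonneg_left (sum_norm_weakPartial_le v i) hC)

theorem MemV.memL4 (hd : d = 2 ∨ d = 3) (hbdd : Bornology.IsBounded Ω) {v : L2Vec Ω}
    (hv : MemV Ω v) : MemL4 v := by
  obtain ⟨C, hC, h⟩ := exists_eLpNorm_four_le_seminormV hd hbdd
  exact fun i => ⟨Lp.aestronglyMeasurable _, (h v hv i).trans_lt ENNReal.ofReal_lt_top⟩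

theorem exists_isTrilinearConstant (hd : d = 2 ∨ d = 3) (hbdd : Bornology.IsBounded Ω) :
    ∃ N : ℝ, IsTrilinearConstant Ω N := by
  obtain ⟨C, hC, h⟩ := exists_eLpNorm_four_le_seminormV hd hbdd
  have hdpos : (0 : ℝ) < d := by rcases hd with rfl | rfl <;> norm_num
  -- One is added to `C` so that the constant is positive.
  refine ⟨d * (d * (2 * ((C + 1) * (C + 1)))), by positivity, fun u v w hu hv hw => ?_⟩
  have h' : ∀ v : L2Vec Ω, MemV Ω v → ∀ i,
      eLpNorm (v i) 4 (volume.restrict Ω) ≤ ENNReal.ofReal ((C + 1) * seminormV Ω v) :=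
    fun v hv i => (h v hv i).trans (ENNReal.ofReal_le_ofReal
      (mul_le_mul_of_nonneg_right (by linarith) (seminormV_nonneg v)))
  have hsu := seminormV_nonneg u
  have hsv := seminormV_nonneg v
  have hsw := seminormV_nonneg w
  have ht : ∀ i j k l, |tripleIntegral Ω (weakPartial Ω j (u i)) (v k) (w l)| ≤
      seminormV Ω u * (((C + 1) * seminormV Ω v) * ((C + 1) * seminormV Ω w)) := fun i j k l =>
    (abs_tripleIntegral_le _ (by positivity) (by positivity) (h' v hv k) (h' w hw l)).trans
      (mul_le_mul_of_nonneg_right (norm_weakPartial_le u i j) (by positivity))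
  rw [aRot_eq hd u (hv.memL4 hd hbdd) (hw.memL4 hd hbdd)]
  calc _ ≤ ∑ i : Fin d, ∑ j : Fin d,
        2 * (seminormV Ω u * (((C + 1) * seminormV Ω v) * ((C + 1) * seminormV Ω w))) := by
        refine (Finset.abs_sum_le_sum_abs _ _).trans (Finset.sum_le_sum fun i _ =>
          (Finset.abs_sum_le_sum_abs _ _).trans (Finset.sum_le_sum fun j _ => ?_))
        refine (abs_sub _ _).trans ?_
        linarith [ht i j j i, ht i j i j]
    _ = _ := by
        simp only [Finset.sum_const, Finset.card_univ, Fintype.card_fin, nsmul_eq_mul]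
        ring

theorem exists_isPoincareConstant (hd : d = 2 ∨ d = 3) (hbdd : Bornology.IsBounded Ω) :
    ∃ C : ℝ, IsPoincareConstant Ω C := by
  obtain ⟨C, hC, h⟩ := exists_norm_le hd hbdd
  refine ⟨d * (C * d) + 1, by positivity, fun v hv => ?_⟩
  have hs := seminormV_nonneg v
  have h1 : ‖v‖ ≤ ∑ i, ‖v i‖ := by
    rw [PiLp.norm_eq_of_L2]
    refine Real.sqrt_le_iff.2 ⟨by positivity, ?_⟩
    exact Finset.sum_sq_le_sq_sum_of_nonneg fun i _ => norm_nonneg _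
  have h2 : ∀ i, ‖v i‖ ≤ C * (d * seminormV Ω v) := fun i =>
    (h _ (memH10_iff.1 (hv i))).trans
      (mul_le_mul_of_nonneg_left (sum_norm_weakPartial_le v i) hC)
  have h3 : ∑ i, ‖v i‖ ≤ d * (C * (d * seminormV Ω v)) := by
    refine (Finset.sum_le_sum fun i _ => h2 i).trans_eq ?_
    simp
  linarith

/-! ### The space `V_div` and the Helmholtz projection -/

theorem MemV.add (hΩ : IsOpen Ω) {u v : L2Vec Ω} (hu : MemV Ω u) (hv : MemV Ω v) :
    MemV Ω (u + v) := fun i => (hu i).add hΩ (hv i)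

theorem MemV.smul (hΩ : IsOpen Ω) {u : L2Vec Ω} (hu : MemV Ω u) (c : ℝ) :
    MemV Ω (c • u) := fun i => (hu i).smul hΩ c

theorem bForm_eq_inner (v : L2Vec Ω) (q : L2 Ω) :
    bForm Ω v q = -inner ℝ (∑ i, gradient Ω v (i, i)) q := by
  rw [L2_inner_eq]
  rfl

theorem gradient_add (hΩ : IsOpen Ω) {u v : L2Vec Ω} (hu : MemV Ω u) (hv : MemV Ω v) :
    gradient Ω (u + v) = gradient Ω u + gradient Ω v := by
  ext1 ij
  exact weakPartial_add hΩ (hu _) (hv _) _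

theorem gradient_smul (hΩ : IsOpen Ω) (c : ℝ) {u : L2Vec Ω} (hu : MemV Ω u) :
    gradient Ω (c • u) = c • gradient Ω u := by
  ext1 ij
  exact weakPartial_smul hΩ (hu _) c _

/-- The space `V_div` as a subspace of `L²(Ω)^d`. Openness of `Ω` makes weak derivatives unique,
hence additive. -/
noncomputable def divFree (hΩ : IsOpen Ω) : Submodule ℝ (L2Vec Ω) where
  carrier := {v | MemVdiv Ω v}
  add_mem' := by
    rintro u v ⟨hu, hu'⟩ ⟨hv, hv'⟩
    refine ⟨hu.add hΩ hv, fun q hq => ?_⟩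
    have a := hu' q hq
    have b := hv' q hq
    rw [bForm_eq_inner] at a b ⊢
    simp_rw [gradient_add hΩ hu hv, PiLp.add_apply, Finset.sum_add_distrib, inner_add_left]
    linarith
  zero_mem' := by
    have h0 : (0 : L2 Ω × (Fin d → L2 Ω)) ∈ (testGraph Ω).topologicalClosure := zero_mem _
    refine ⟨fun i => memH10_of_mem_closure hΩ h0, fun q _ => ?_⟩
    have : gradient Ω (0 : L2Vec Ω) = 0 := by
      ext1 ij
      exact weakPartial_eq_of_mem_closure hΩ h0 _
    rw [bForm_eq_inner, this]
    simp
  smul_mem' := by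
    rintro c u ⟨hu, hu'⟩
    refine ⟨hu.smul hΩ c, fun q hq => ?_⟩
    have a := hu' q hq
    rw [bForm_eq_inner] at a ⊢
    simp_rw [gradient_smul hΩ c hu, PiLp.smul_apply, ← Finset.smul_sum, real_inner_smul_left]
    rw [← mul_neg, a, mul_zero]

/-- The gradient on `V_div`; the energy form `a` is the inner product it pulls back. -/
noncomputable def gradientLinear (hΩ : IsOpen Ω) :
    divFree hΩ →ₗ[ℝ] PiLp 2 fun _ : Fin d × Fin d => L2 Ω where
  toFun v := gradient Ω v
  map_add' u v := gradient_add hΩ u.2.1 v.2.1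
  map_smul' c u := gradient_smul hΩ c u.2.1

theorem norm_le_norm_gradientLinear (hΩ : IsOpen Ω) {C : ℝ} (hC : IsPoincareConstant Ω C)
    (v : divFree hΩ) : ‖v‖ ≤ C * ‖gradientLinear hΩ v‖ := by
  have := hC.2 v v.2.1
  rwa [seminormV_eq_norm] at this

theorem gradientLinear_injective (hΩ : IsOpen Ω) {C : ℝ} (hC : IsPoincareConstant Ω C) :
    Function.Injective (gradientLinear hΩ) := by
  refine (injective_iff_map_eq_zero _).2 fun v hv => ?_
  have := norm_le_norm_gradientLinear hΩ hC v
  rw [hv, norm_zero, mul_zero] at this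
  exact norm_le_zero_iff.1 this

/-- `V_div` is complete for the energy norm: by the Poincaré inequality, convergence of gradients
forces convergence in `L²`, and then the pairs `(v, ∇v)` converge in a closed set. -/
theorem isComplete_range_gradientLinear (hΩ : IsOpen Ω) {C : ℝ} (hC : IsPoincareConstant Ω C) :
    IsComplete (Set.range (gradientLinear hΩ)) := by
  refine IsClosed.isComplete (isClosed_of_closure_subset fun y hy => ?_)
  obtain ⟨z, hz, hlim⟩ := mem_closure_iff_seq_limit.1 hy
  choose v hv using hz
  have hcauchy : CauchySeq fun n => (v n : L2Vec Ω) := by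
    have hz := hlim.cauchySeq
    rw [Metric.cauchySeq_iff] at hz ⊢
    intro ε hε
    obtain ⟨n₀, hn₀⟩ := hz (ε / C) (div_pos hε hC.1)
    refine ⟨n₀, fun m hm n hn => ?_⟩
    have h1 := norm_le_norm_gradientLinear hΩ hC (v m - v n)
    rw [map_sub, hv, hv] at h1
    have h2 := hn₀ m hm n hn
    rw [lt_div_iff₀ hC.1, dist_eq_norm] at h2
    rw [dist_eq_norm]
    have h3 : ‖(v m : L2Vec Ω) - v n‖ = ‖v m - v n‖ := rfl
    linarith
  obtain ⟨w, hw⟩ := cauchySeq_tendsto_of_complete hcauchy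
  have hpair : ∀ i, ((w i, fun j => y (i, j)) : L2 Ω × (Fin d → L2 Ω)) ∈
      (testGraph Ω).topologicalClosure := by
    intro i
    refine (Submodule.isClosed_topologicalClosure _).mem_of_tendsto
      (f := fun n => (((v n : L2Vec Ω) i, fun j => z n (i, j)) : L2 Ω × (Fin d → L2 Ω))) (b := atTop)
      ?_ (Eventually.of_forall fun n => ?_)
    · rw [Prod.tendsto_iff, tendsto_pi_nhds]
      exact ⟨((PiLp.continuous_apply 2 _ i).tendsto w).comp hw,
        fun j => ((PiLp.continuous_apply 2 _ (i, j)).tendsto y).comp hlim⟩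
    · rw [← hv n]
      exact memH10_iff.1 ((v n).2.1 i)
  have hgrad : gradient Ω w = y := by
    ext1 ij
    exact weakPartial_eq_of_mem_closure hΩ (hpair ij.1) ij.2
  refine ⟨⟨w, fun i => memH10_of_mem_closure hΩ (hpair i), fun q hq => ?_⟩, hgrad⟩
  rw [bForm_eq_inner, hgrad]
  have hcl : IsClosed {y : PiLp 2 fun _ : Fin d × Fin d => L2 Ω |
      -inner ℝ (∑ i, y (i, i)) q = 0} := isClosed_eq (by fun_prop) continuous_const
  refine hcl.mem_of_tendsto hlim (Eventually.of_forall fun n => ?_)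
  have := (v n).2.2 q hq
  rw [bForm_eq_inner] at this
  rw [← hv n]
  exact this

/-- `V_div ⊆ 𝓗`: integrating by parts, `∫_Ω v · ∇q = -∫_Ω (div v) q = 0`. -/
theorem MemVdiv.mem_solenoidal {v : L2Vec Ω} (hv : MemVdiv Ω v) : v ∈ solenoidal Ω := by
  intro q hq hq0
  have h := hv.2 q hq0
  rw [bForm_eq_inner, sum_inner, ← Finset.sum_neg_distrib] at h
  rw [load_eq_inner, PiLp.inner_apply, ← h]
  refine Finset.sum_congr rfl fun i _ => ?_
  have := (weakPartial_spec hq i).inner_eq (memH10_iff.1 (hv.1 i))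
  simp only at this
  rw [real_inner_comm]
  change inner ℝ (weakPartial Ω i q) (v i) = -inner ℝ (weakPartial Ω i (v i)) q
  rw [real_inner_comm q, this, neg_neg]

/-- Only the solenoidal part of the force acts on `V_div`. -/
theorem abs_load_le {C : ℝ} (hC : IsPoincareConstant Ω C) (f : L2Vec Ω) {v : L2Vec Ω}
    (hv : MemVdiv Ω v) : |load Ω f v| ≤ C * ‖helmholtz Ω f‖ * seminormV Ω v := by
  have h1 : load Ω f v = inner ℝ (helmholtz Ω f) v := by
    rw [load_eq_inner, helmholtz, Submodule.inner_starProjection_left_eq_right,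
      Submodule.starProjection_eq_self_iff.2 hv.mem_solenoidal]
  rw [h1]
  calc _ ≤ ‖helmholtz Ω f‖ * ‖v‖ := abs_real_inner_le_norm _ _
    _ ≤ ‖helmholtz Ω f‖ * (C * seminormV Ω v) := by gcongr; exact hC.2 v hv.1
    _ = _ := by ring

end RotNS

theorem mainTheorem6 (d : ℕ) (hd : d = 2 ∨ d = 3) (Ω : Set (EuclideanSpace ℝ (Fin d)))
    (hopen : IsOpen Ω) (hconn : IsConnected Ω) (hbdd : Bornology.IsBounded Ω) :
    (∀ u v w : RotNS.L2Vec Ω, RotNS.MemV Ω u → RotNS.MemV Ω v → RotNS.MemV Ω w →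
      IntegrableOn (RotNS.rotIntegrand Ω u v w) Ω) ∧
    (∃ N : ℝ, RotNS.IsTrilinearConstant Ω N) ∧
    (∃ CP : ℝ, RotNS.IsPoincareConstant Ω CP) ∧
    ∀ (N CP ν : ℝ) (f : RotNS.L2Vec Ω),
      RotNS.IsTrilinearConstant Ω N → RotNS.IsPoincareConstant Ω CP → 0 < ν →
      (∀ u : RotNS.L2Vec Ω, RotNS.IsReducedSolution Ω ν f u →
        RotNS.seminormV Ω u ≤ CP / ν * ‖RotNS.helmholtz Ω f‖) ∧
      (N * CP / ν ^ 2 * ‖RotNS.helmholtz Ω f‖ < 1 →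
        ∃! u : RotNS.L2Vec Ω, RotNS.IsReducedSolution Ω ν f u) := by
  have hL4 : ∀ v : RotNS.divFree hopen, RotNS.MemL4 (v : RotNS.L2Vec Ω) :=
    fun v => RotNS.MemV.memL4 hd hbdd v.2.1
  refine ⟨fun u v w _ hv hw => RotNS.integrable_rotIntegrand hd u (hv.memL4 hd hbdd)
    (hw.memL4 hd hbdd), RotNS.exists_isTrilinearConstant hd hbdd,
    RotNS.exists_isPoincareConstant hd hbdd, fun N CP ν f hN hC hν => ⟨fun u hu => ?_, fun h => ?_⟩⟩
  · have hK : 0 ≤ CP * ‖RotNS.helmholtz Ω f‖ := mul_nonneg hC.1.le (norm_nonneg _)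
    have e := hu.2 u hu.1
    rw [RotNS.aForm_eq_inner] at e
    have hℓ := RotNS.abs_load_le hC f hu.1
    rw [RotNS.seminormV_eq_norm] at hℓ ⊢
    refine (RotNS.norm_le_of_energy (b := fun _ => RotNS.aRot Ω u u u)
      (ℓ := fun _ => RotNS.load Ω f u) hν hK (RotNS.aRot_self_right hd u u) hℓ e).trans_eq ?_
    ring
  · obtain ⟨u, hu, huniq⟩ := RotNS.existsUnique_of_small_of_range (RotNS.gradientLinear hopen)
      (RotNS.gradientLinear_injective hopen hC) (RotNS.isComplete_range_gradientLinear hopen hC)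
      (N := N) (K := CP * ‖RotNS.helmholtz Ω f‖)
      (b := fun u v w => RotNS.aRot Ω u v w) (ℓ := fun v => RotNS.load Ω f v)
      hν hN.1 (mul_nonneg hC.1.le (norm_nonneg _))
      (fun v w => ⟨fun u u' => RotNS.aRot_add_left hd hopen u.2.1 u'.2.1 (hL4 v) (hL4 w),
        fun c u => RotNS.aRot_smul_left hd hopen c u.2.1 (hL4 v) (hL4 w)⟩)
      (fun u w => ⟨fun v v' => RotNS.aRot_add_mid hd u.1 (hL4 v) (hL4 v') (hL4 w),
        fun c v => RotNS.aRot_smul_mid hd c u.1 (hL4 v) (hL4 w)⟩)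
      (fun u v => ⟨fun w w' => RotNS.aRot_add_right hd u.1 (hL4 v) (hL4 w) (hL4 w'),
        fun c w => RotNS.aRot_smul_right hd c u.1 (hL4 v) (hL4 w)⟩)
      (fun u v w => by
        have := hN.2 u v w u.2.1 v.2.1 w.2.1
        simp only [RotNS.seminormV_eq_norm] at this
        exact this)
      (fun u v => RotNS.aRot_self_right hd u.1 v.1)
      ⟨fun v v' => by simp only [RotNS.load_eq_inner, Submodule.coe_add, inner_add_right],
        fun c v => by
          simp only [RotNS.load_eq_inner, Submodule.coe_smul, real_inner_smul_right, smul_eq_mul]⟩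
      (fun v => by
        have := RotNS.abs_load_le hC f v.2
        rwa [RotNS.seminormV_eq_norm] at this)
      (by rw [← mul_assoc, mul_div_right_comm]; exact h)
    refine ⟨u, ⟨u.2, fun v hv => ?_⟩, fun u' hu' => ?_⟩
    · rw [RotNS.aForm_eq_inner]
      exact hu ⟨v, hv⟩
    · refine congrArg Subtype.val (huniq ⟨u', hu'.1⟩ fun v => ?_)
      have := hu'.2 v v.2
      rw [RotNS.aForm_eq_inner] at this
      exact this
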